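/- Let $\mathcal X,\mathcal Y$ be measurable spaces (singletons of $\mathcal Y$ being measurable), $\ell:\mathcal Y\times\mathcal Y\to\mathbb R$ a measurable loss function and $\mathcal Z=\mathcal X\times\mathcal Y$. For a probability distribution $P$ on $\mathcal Z$ and a prediction function $g$ (a measurable function $\mathcal X\to\mathcal Y$) let $R_P(g)=\mathbb E_{(X,Y)\sim P}\,\ell(Y,g(X))$. **Hypercubes.** Let $m\ge 1$. An $m$-dimensional hypercube is a family $\{P_{\bar\sigma}:\bar\sigma\in\{-,+\}^m\}$ of probability distributions on $\mathcal Z$ with the same first marginal $\mu$, for which there are a measurable partition $\mathcal X_0,\dots,\mathcal X_m$ of $\mathcal X$ with $\mu(\mathcal X_1)=\dots=\mu(\mathcal X_m)=:w$ (the edge probability), two distinct outputs $h_1\ne h_2$ in $\mathcal Y$ and numbers $0\le p_-<p_+\le 1$ such that for $1\le j\le m$ and $x\in\mathcal X_j$, $$P_{\bar\sigma}(Y=h_1\mid X=x)=p_{\sigma_j}=1-P_{\bar\sigma}(Y=h_2\mid X=x),$$ while for $x\in\mathcal X_0$ the conditional distribution of $Y$ given $X=x$ does not depend on $\bar\sigma$.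 With $$\phi(p)=\inf_{y\in\mathcal Y}\{p\,\ell(h_1,y)+(1-p)\,\ell(h_2,y)\},$$ the edge discrepancies of the hypercube are $$d_{\rm I}=\phi\Big(\frac{p_++p_-}{2}\Big)-\frac{\phi(p_+)+\phi(p_-)}{2},\qquad d_{\rm II}=\Big(\sqrt{p_+(1-p_-)}-\sqrt{(1-p_+)p_-}\Big)^2 .$$ **Theorem 8.2.** Let $\mathcal P$ be a set of probability distributions on $\mathcal Z$, each with finite minimal risk $\inf_g R_P(g)$ (the infimum is over all prediction functions), and suppose that $\mathcal P$ contains an $m$-dimensional hypercube with edge probability $w$ and edge discrepancies $d_{\rm I}$ and $d_{\rm II}$. Let $n\ge 1$. For every (measurable, deterministic) estimator $\hat g$, which maps a sample $Z_1^n\in\mathcal Z^n$ to a prediction function $\hat g_{Z_1^n}$, write $$\mathcal E(\hat g)=\sup_{P\in\mathcal P}\Big\{\mathbb E_{Z_1^n\sim P^{\otimes n}}R_P(\hat g_{Z_1^n})-\inf_g R_P(g)\Big\}\in(-\infty,+\infty].$$ 1. Both $$\mathcal E(\hat g)\ \ge\ m w d_{\rm I}\Big(1-\sqrt{1-(1-d_{\rm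 II})^{nw}}\Big)\qquad\text{and}\qquad \mathcal E(\hat g)\ \ge\ m w d_{\rm I}\Big(1-\sqrt{n w d_{\rm II}}\Big)$$ hold; moreover, when $nw\ge 1$, the first of these two lower bounds is at least as large as the second. 2. When $p_+=1=1-p_-$, also $\mathcal E(\hat g)\ \ge\ m w d_{\rm I}(1-w)^n$. -/

import Mathlib

open MeasureTheory ProbabilityTheory
open scoped ENNReal

noncomputable section

namespace Learning

/-- Expectation of an extended-real valued function, `E[f⁺] - E[f⁻]`.  It is the usual expectation
as soon as one of the two terms is finite; the value is `⊥` if both of them are infinite. -/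
def expect {α : Type*} [MeasurableSpace α] (μ : Measure α) (f : α → EReal) : EReal :=
  ((∫⁻ a, (f a).toENNReal ∂μ : ℝ≥0∞) : EReal) - ((∫⁻ a, (-f a).toENNReal ∂μ : ℝ≥0∞) : EReal)

section Risk

variable {X Y : Type*} [MeasurableSpace X] [MeasurableSpace Y]

/-- The risk `R(g) = E_{(X,Y) ∼ P} ℓ(Y, g(X))` of a prediction function `g`. -/
def risk (ℓ : Y → Y → ℝ) (P : ProbabilityMeasure (X × Y)) (g : X → Y) : EReal :=
  expect (P : Measure (X × Y)) (fun z => ((ℓ z.2 (g z.1) : ℝ) : EReal))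

/-- The smallest risk over the space of all prediction functions,
i.e. of all measurable functions from `X` to `Y`. -/
def optimalRisk (ℓ : Y → Y → ℝ) (P : ProbabilityMeasure (X × Y)) : EReal :=
  ⨅ (g : X → Y) (_ : Measurable g), risk ℓ P g

/-- The expected risk `E_{Z₁ⁿ ∼ P^{⊗n}} R(ĝ_{Z₁ⁿ})` of an estimator trained on `n` i.i.d. pairs. -/
def expectedRisk (ℓ : Y → Y → ℝ) (P : ProbabilityMeasure (X × Y)) {n : ℕ}
    (gHat : (Fin n → X × Y) → X → Y) : EReal :=
  expect (Measure.pi (fun _ : Fin n => (P : Measure (X × Y)))) (fun z => risk ℓ P (gHat z))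

/-- The largest expected excess risk `sup_{P ∈ 𝓟} {E R(ĝ) - min_g R(g)}` of an estimator. -/
def maxExcessRisk (ℓ : Y → Y → ℝ) (𝓟 : Set (ProbabilityMeasure (X × Y))) {n : ℕ}
    (gHat : (Fin n → X × Y) → X → Y) : EReal :=
  ⨆ P ∈ 𝓟, (expectedRisk ℓ P gHat - optimalRisk ℓ P)

end Risk

section TwoPoint

variable {Y : Type*}

/-- `φ_p(y) = p ℓ(h₁, y) + (1 - p) ℓ(h₂, y)`. -/
def twoPointRisk (ℓ : Y → Y → ℝ) (h₁ h₂ : Y) (p : ℝ) (y : Y) : ℝ :=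
  p * ℓ h₁ y + (1 - p) * ℓ h₂ y

/-- `ϕ(p) = inf_y φ_p(y)`. -/
def bestTwoPointRisk (ℓ : Y → Y → ℝ) (h₁ h₂ : Y) (p : ℝ) : ℝ :=
  ⨅ y : Y, twoPointRisk ℓ h₁ h₂ p y

/-- `ψ_{q₊,q₋}(α) = ϕ(α q₊ + (1 - α) q₋) - α ϕ(q₊) - (1 - α) ϕ(q₋)`. -/
def psi (ℓ : Y → Y → ℝ) (h₁ h₂ : Y) (qPlus qMinus α : ℝ) : ℝ :=
  bestTwoPointRisk ℓ h₁ h₂ (α * qPlus + (1 - α) * qMinus)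
    - α * bestTwoPointRisk ℓ h₁ h₂ qPlus - (1 - α) * bestTwoPointRisk ℓ h₁ h₂ qMinus

end TwoPoint

/-- An `m`-dimensional hypercube of probability distributions on `X × Y`.  A sign vector
`σ ∈ {-;+}^m` is a function `Fin m → Bool`, where `true` stands for `+`. -/
structure Hypercube (X Y : Type*) [MeasurableSpace X] [MeasurableSpace Y] (m : ℕ) where
  /-- The `2^m` distributions `P_σ`. -/
  P : (Fin m → Bool) → ProbabilityMeasure (X × Y)
  /-- The distribution under `P_σ` of the output knowing the input. -/
  cond : (Fin m → Bool) → Kernel X Y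
  /-- The partition `X_0, …, X_m` of the input space. -/
  part : Fin (m + 1) → Set X
  /-- The two output values. -/
  h₁ : Y
  h₂ : Y
  /-- The probabilities `p₊` and `p₋`. -/
  pPlus : ℝ
  pMinus : ℝ
  /-- The edge probability, i.e. the common mass of `X_1, …, X_m`. -/
  w : ℝ
  dim_pos : 1 ≤ m
  isMarkovKernel_cond : ∀ σ, IsMarkovKernel (cond σ)
  /-- All the `P_σ` have the same first marginal. -/
  fst_eq : ∀ σ, (P σ : Measure (X × Y)).fst = (P (fun _ => true) : Measure (X × Y)).fst
  /-- `cond σ` is a conditional distribution of the output knowing the input under `P_σ`. -/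
  disintegration : ∀ σ, (P σ : Measure (X × Y)) = (P σ : Measure (X × Y)).fst ⊗ₘ cond σ
  measurableSet_part : ∀ j, MeasurableSet (part j)
  disjoint_part : ∀ i j, i ≠ j → Disjoint (part i) (part j)
  iUnion_part : ⋃ j, part j = Set.univ
  mass_part : ∀ j : Fin m, (P (fun _ => true) : Measure (X × Y)).fst.real (part j.succ) = w
  h_ne : h₁ ≠ h₂
  pMinus_nonneg : 0 ≤ pMinus
  pMinus_lt_pPlus : pMinus < pPlus
  pPlus_le_one : pPlus ≤ 1
  /-- On `X_j`, `j ≥ 1`, the output is `h₁` with probability `p_{σ_j}`, and `h₂` otherwise. -/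
  cond_h₁ : ∀ σ (j : Fin m), ∀ x ∈ part j.succ,
    (cond σ x).real {h₁} = if σ j then pPlus else pMinus
  cond_h₂ : ∀ σ (j : Fin m), ∀ x ∈ part j.succ,
    (cond σ x).real {h₂} = 1 - if σ j then pPlus else pMinus
  /-- On `X_0` the conditional distribution of the output does not depend on `σ`. -/
  cond_zero : ∀ σ τ, ∀ x ∈ part 0, cond σ x = cond τ x

namespace Hypercube

variable {X Y : Type*} [MeasurableSpace X] [MeasurableSpace Y] {m : ℕ}

/-- The edge discrepancy of type I. -/
def dI (H : Hypercube X Y m) (ℓ : Y → Y → ℝ) : ℝ :=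
  psi ℓ H.h₁ H.h₂ H.pPlus H.pMinus (1 / 2)

/-- The edge discrepancy of type II. -/
def dII (H : Hypercube X Y m) : ℝ :=
  (√(H.pPlus * (1 - H.pMinus)) - √((1 - H.pPlus) * H.pMinus)) ^ 2

end Hypercube

end Learning

end

/-! The argument is Assouad's. The excess risk under `P σ` is at least the sum of its contributions
from the cells, and each cell poses a two-point testing problem. On a cell, the excess two-point
risks of one output under the two signs add up to at least `2 * dI` (`ofReal_two_mul_dI_le`), so an
estimator cannot do well at two vertices that differ in one sign unless the sample tells them apart.
Pairing the vertices along each coordinate and averaging over the cube yields a vertex with large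
total excess (`exists_le_sum_expectedEdgeExcess`).

How well a sample separates two such vertices is controlled by recursion on its size. Let `G n s t`
bound below the weighted error `s α + t β` of a test. A new observation off the cell leaves the
weights unchanged; one in the cell multiplies them by the likelihoods of its output under the two
signs. Every `G` compatible with this recursion (`IsEdgeTestBound`) gives a minimax bound
(`le_maxExcessRisk`). Two choices are used: `testBound` with squared affinity `(1 - w * dII) ^ n`,
whose value at weights `1, 1` becomes both bounds of the first item through Bernoulli inequalities,
and `min s t * (1 - w) ^ n` for noiseless outputs. -/

noncomputable section

namespace Learning

/-! ### Real inequalities behind the testing bounds -/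

section RealInequalities

/-- This is the reverse triangle inequality for the form `a² - u x²`. It follows from the reverse
Cauchy-Schwarz inequality, that is, from `(ab - uxy)² - (a² - ux²)(b² - uy²) = u (ay - bx)²`. -/
lemma sqrt_sq_sub_add_sqrt_sq_sub_le {a b x y u : ℝ} (hx : 0 ≤ x) (hxa : x ≤ a) (hy : 0 ≤ y)
    (hyb : y ≤ b) (hu : 0 ≤ u) (hu1 : u ≤ 1) :
    √(a ^ 2 - u * x ^ 2) + √(b ^ 2 - u * y ^ 2) ≤ √((a + b) ^ 2 - u * (x + y) ^ 2) := by
  have nonneg : ∀ {c z : ℝ}, 0 ≤ z → z ≤ c → 0 ≤ c ^ 2 - u * z ^ 2 := fun {c z} hz hzc => by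
    nlinarith [mul_le_mul_of_nonneg_right hu1 (sq_nonneg z)]
  have hA := nonneg hx hxa
  have hB := nonneg hy hyb
  have hxy : u * (x * y) ≤ a * b :=
    (mul_le_of_le_one_left (mul_nonneg hx hy) hu1).trans
      (mul_le_mul hxa hyb hy (hx.trans hxa))
  have key : √(a ^ 2 - u * x ^ 2) * √(b ^ 2 - u * y ^ 2) ≤ a * b - u * (x * y) := by
    rw [← Real.sqrt_mul hA]
    refine Real.sqrt_le_iff.2 ⟨by linarith, ?_⟩
    nlinarith [mul_nonneg hu (sq_nonneg (a * y - b * x))]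
  refine Real.le_sqrt_of_sq_le ?_
  nlinarith [Real.sq_sqrt hA, Real.sq_sqrt hB]

lemma one_sub_mul_sqrt_add_mul_sqrt_le {a b w : ℝ} (ha : 0 ≤ a) (hb : 0 ≤ b) (hw : 0 ≤ w)
    (hw1 : w ≤ 1) : (1 - w) * √a + w * √b ≤ √((1 - w) * a + w * b) := by
  have := Real.strictConcaveOn_sqrt.concaveOn.2 (Set.mem_Ici.2 ha) (Set.mem_Ici.2 hb)
    (sub_nonneg.2 hw1) hw (sub_add_cancel 1 w)
  simpa only [smul_eq_mul] using this

/-- A lower bound on `s α + t β` over the tests with error probabilities `α` and `β`, when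
the squared affinity of the two hypotheses is `u`. -/
def testBound (u s t : ℝ) : ℝ := (s + t) / 2 - √(((s + t) / 2) ^ 2 - u * (s * t))

lemma testBound_one {s t : ℝ} : testBound 1 s t = min s t := by
  have : ((s + t) / 2) ^ 2 - 1 * (s * t) = ((s - t) / 2) ^ 2 := by ring
  rw [testBound, this, Real.sqrt_sq_eq_abs, abs_div, abs_of_pos (two_pos : (0 : ℝ) < 2)]
  linarith [min_add_max s t, max_sub_min_eq_abs' s t]

/-- One more observation multiplies the squared affinity by that of a single pair. The reverse
triangle inequality, applied to the arithmetic and geometric means of the updated weights, merges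
the two outcomes inside the cell; concavity of the square root then merges the inside with the
outside. -/
lemma testBound_mul_le {u s t w p q : ℝ} (hu : 0 ≤ u) (hu1 : u ≤ 1) (hs : 0 ≤ s) (ht : 0 ≤ t)
    (hw : 0 ≤ w) (hw1 : w ≤ 1) (hp : 0 ≤ p) (hp1 : p ≤ 1) (hq : 0 ≤ q) (hq1 : q ≤ 1) :
    testBound (u * (1 - w + w * (√(p * q) + √((1 - p) * (1 - q))) ^ 2)) s t ≤
      (1 - w) * testBound u s t
        + w * (testBound u (s * p) (t * q) + testBound u (s * (1 - p)) (t * (1 - q))) := by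
  have amgm : ∀ {a b : ℝ}, 0 ≤ a → 0 ≤ b → √(a * b) ≤ (a + b) / 2 := fun {a b} ha hb =>
    Real.sqrt_le_iff.2 ⟨by positivity, by nlinarith [sq_nonneg (a - b)]⟩
  have hp' := sub_nonneg.2 hp1
  have hq' := sub_nonneg.2 hq1
  have hst := mul_nonneg hs ht
  set x := √(s * p * (t * q)) with hx
  set y := √(s * (1 - p) * (t * (1 - q))) with hy
  have hx2 : x ^ 2 = s * p * (t * q) := Real.sq_sqrt (by positivity)
  have hy2 : y ^ 2 = s * (1 - p) * (t * (1 - q)) := Real.sq_sqrt (by positivity)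
  have hxe : x = √(s * t) * √(p * q) := by
    rw [hx, ← Real.sqrt_mul hst]; congr 1; ring
  have hye : y = √(s * t) * √((1 - p) * (1 - q)) := by
    rw [hy, ← Real.sqrt_mul hst]; congr 1; ring
  have hxy : (x + y) ^ 2 = s * t * (√(p * q) + √((1 - p) * (1 - q))) ^ 2 := by
    rw [hxe, hye, ← mul_add, mul_pow, Real.sq_sqrt hst]
  have h1 := sqrt_sq_sub_add_sqrt_sq_sub_le (Real.sqrt_nonneg _)
    (amgm (mul_nonneg hs hp) (mul_nonneg ht hq)) (Real.sqrt_nonneg _)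
    (amgm (mul_nonneg hs hp') (mul_nonneg ht hq')) hu hu1
  rw [← hx, ← hy, hx2, hy2, hxy] at h1
  have hsum : (s * p + t * q) / 2 + (s * (1 - p) + t * (1 - q)) / 2 = (s + t) / 2 := by ring
  rw [hsum] at h1
  have hxyle : x + y ≤ (s + t) / 2 := by
    have := amgm (mul_nonneg hs hp) (mul_nonneg ht hq)
    have := amgm (mul_nonneg hs hp') (mul_nonneg ht hq')
    linarith
  have hB : 0 ≤ ((s + t) / 2) ^ 2
      - u * (s * t * (√(p * q) + √((1 - p) * (1 - q))) ^ 2) := by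
    rw [← hxy]
    have h0 : 0 ≤ x + y := by positivity
    nlinarith [mul_le_mul_of_nonneg_right hu1 (sq_nonneg (x + y))]
  have hA : 0 ≤ ((s + t) / 2) ^ 2 - u * (s * t) := by
    nlinarith [mul_le_mul_of_nonneg_right hu1 hst, sq_nonneg (s - t)]
  have h2 := one_sub_mul_sqrt_add_mul_sqrt_le hA hB hw hw1
  have h3 := mul_le_mul_of_nonneg_left h1 hw
  have he : (1 - w) * (((s + t) / 2) ^ 2 - u * (s * t)) + w * (((s + t) / 2) ^ 2
      - u * (s * t * (√(p * q) + √((1 - p) * (1 - q))) ^ 2)) =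
      ((s + t) / 2) ^ 2
        - u * (1 - w + w * (√(p * q) + √((1 - p) * (1 - q))) ^ 2) * (s * t) := by ring
  rw [he] at h2
  simp only [testBound]
  linarith

/-- The edge discrepancy of type II is one minus the squared affinity of the two edges. -/
lemma sqrt_mul_add_sqrt_mul_sq {p q : ℝ} (hp : 0 ≤ p) (hp1 : p ≤ 1) (hq : 0 ≤ q) (hq1 : q ≤ 1) :
    (√(p * q) + √((1 - p) * (1 - q))) ^ 2
      = 1 - (√(p * (1 - q)) - √((1 - p) * q)) ^ 2 := by
  have hp' := sub_nonneg.2 hp1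
  have hq' := sub_nonneg.2 hq1
  have h : √(p * q) * √((1 - p) * (1 - q)) = √(p * (1 - q)) * √((1 - p) * q) := by
    rw [← Real.sqrt_mul (by positivity), ← Real.sqrt_mul (by positivity)]
    congr 1; ring
  have h1 := Real.sq_sqrt (mul_nonneg hp hq)
  have h2 := Real.sq_sqrt (mul_nonneg hp' hq')
  have h3 := Real.sq_sqrt (mul_nonneg hp hq')
  have h4 := Real.sq_sqrt (mul_nonneg hp' hq)
  linear_combination h1 + h2 + 2 * h + h3 + h4

/-- Bernoulli's inequality with exponent `w ≤ 1`, raised to the power `n`. -/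
lemma rpow_mul_le_one_sub_mul_pow {d w : ℝ} (hd : d ≤ 1) (hw : 0 ≤ w) (hw1 : w ≤ 1) (n : ℕ) :
    (1 - d) ^ ((n : ℝ) * w) ≤ (1 - w * d) ^ n := by
  have h0 : 0 ≤ 1 - d := sub_nonneg.2 hd
  rw [mul_comm, Real.rpow_mul h0, Real.rpow_natCast]
  have := rpow_one_add_le_one_add_mul_self (s := -d) (by linarith) hw hw1
  refine pow_le_pow_left₀ (Real.rpow_nonneg h0 _) ?_ n
  rw [sub_eq_add_neg]
  linarith

end RealInequalities

/-! ### Expectations of extended-real functions -/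

section Expect

variable {α : Type*} [MeasurableSpace α]

lemma expect_coe_of_integrable {μ : Measure α} {f : α → ℝ} (hf : Integrable f μ) :
    expect μ (fun a => (f a : EReal)) = ((∫ a, f a ∂μ : ℝ) : EReal) := by
  have h1 : ∫⁻ a, ENNReal.ofReal (f a) ∂μ ≠ ⊤ := hf.lintegral_lt_top.ne
  have h2 : ∫⁻ a, ENNReal.ofReal (-f a) ∂μ ≠ ⊤ := hf.neg.lintegral_lt_top.ne
  rw [integral_eq_lintegral_pos_part_sub_lintegral_neg_part hf, EReal.coe_sub,
    EReal.coe_ennreal_toReal h1, EReal.coe_ennreal_toReal h2]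
  rfl

lemma integrable_of_expect_coe {μ : Measure α} {f : α → ℝ} (hf : Measurable f)
    (hbot : expect μ (fun a => (f a : EReal)) ≠ ⊥)
    (htop : expect μ (fun a => (f a : EReal)) ≠ ⊤) : Integrable f μ := by
  have he : expect μ (fun a => (f a : EReal)) = ((∫⁻ a, ENNReal.ofReal (f a) ∂μ : ℝ≥0∞) : EReal)
      - ((∫⁻ a, ENNReal.ofReal (-f a) ∂μ : ℝ≥0∞) : EReal) := rfl
  -- Since `⊤ - ⊤ = ⊥`, an infinite negative part forces the value `⊥`, whatever the positive part.
  have h2 : ∫⁻ a, ENNReal.ofReal (-f a) ∂μ ≠ ⊤ := fun h => hbot (by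
    rw [he, h, EReal.coe_ennreal_top, EReal.sub_top])
  have h1 : ∫⁻ a, ENNReal.ofReal (f a) ∂μ ≠ ⊤ := fun h => htop (by
    rw [he, h, EReal.coe_ennreal_top, EReal.top_sub (by simpa using h2)])
  refine ⟨hf.aestronglyMeasurable, ?_⟩
  have habs : ∀ a, ‖f a‖ₑ = ENNReal.ofReal (f a) + ENNReal.ofReal (-f a) := fun a => by
    rw [Real.enorm_eq_ofReal_abs]
    rcases le_total 0 (f a) with h | h
    · simp [abs_of_nonneg h, ENNReal.ofReal_of_nonpos (neg_nonpos.2 h)]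
    · simp [abs_of_nonpos h, ENNReal.ofReal_of_nonpos h]
  rw [HasFiniteIntegral]
  simp_rw [habs]
  rw [lintegral_add_left hf.ennreal_ofReal]
  exact ENNReal.add_lt_top.2 ⟨h1.lt_top, h2.lt_top⟩

lemma toENNReal_neg_add_le_of_add_le {x : EReal} {c : ℝ} {E : ℝ≥0∞} (h : (c : EReal) + E ≤ x) :
    (-x).toENNReal + ENNReal.ofReal c + E ≤ x.toENNReal + ENNReal.ofReal (-c) := by
  induction x with
  | bot =>
    have := le_bot_iff.1 h
    rw [EReal.add_eq_bot_iff] at this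
    simp at this
  | top => simp
  | coe r =>
    have hE : E ≠ ⊤ := by
      rintro rfl
      simp at h
    lift E to NNReal using hE
    have h' : c + E ≤ r := EReal.coe_le_coe_iff.1 h
    rw [← EReal.coe_neg, EReal.real_coe_toENNReal, EReal.real_coe_toENNReal]
    simp only [ENNReal.ofReal]
    norm_cast
    rw [← NNReal.coe_le_coe]
    push_cast
    simp only [Real.coe_toNNReal']
    have := E.2
    grind

/-- No measurability of `f` is needed: the inequality is rearranged into sums of nonnegative terms,
where monotonicity and additivity against `E` and constants suffice. -/
lemma le_expect_of_forall_add_le {μ : Measure α} [IsProbabilityMeasure μ] {f : α → EReal} {c : ℝ}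
    {E : α → ℝ≥0∞} (hE : Measurable E) (h : ∀ a, (c : EReal) + E a ≤ f a) :
    (c : EReal) + (∫⁻ a, E a ∂μ : ℝ≥0∞) ≤ expect μ f := by
  have hint := lintegral_mono (μ := μ) fun a => toENNReal_neg_add_le_of_add_le (h a)
  rw [lintegral_add_right _ hE, lintegral_add_right _ measurable_const,
    lintegral_add_right _ measurable_const] at hint
  simp only [lintegral_const, measure_univ, mul_one] at hint
  have hneg : ∫⁻ a, (-f a).toENNReal ∂μ ≠ ⊤ := by
    refine ne_top_of_le_ne_top (ENNReal.ofReal_ne_top (r := -c)) ?_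
    calc ∫⁻ a, (-f a).toENNReal ∂μ ≤ ∫⁻ _, ENNReal.ofReal (-c) ∂μ := by
          refine lintegral_mono fun a => ?_
          rw [← EReal.real_coe_toENNReal, EReal.coe_neg]
          refine EReal.toENNReal_le_toENNReal (EReal.neg_le_neg_iff.2 (le_trans ?_ (h a)))
          exact le_add_of_nonneg_right (EReal.coe_ennreal_nonneg _)
      _ = ENNReal.ofReal (-c) := by simp
  rw [expect, EReal.le_sub_iff_add_le (Or.inl (EReal.coe_ennreal_ne_bot _))
    (Or.inl (by simpa using hneg))]
  have hc : (c : EReal) + (ENNReal.ofReal (-c) : ℝ≥0∞) = (ENNReal.ofReal c : ℝ≥0∞) := by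
    rw [EReal.coe_ennreal_ofReal, EReal.coe_ennreal_ofReal]
    norm_cast
    rcases le_total 0 c with h | h
    · simp [h]
    · simp [h]
  have hint' : ((∫⁻ a, (-f a).toENNReal ∂μ : ℝ≥0∞) : EReal) + (ENNReal.ofReal c : ℝ≥0∞)
      + (∫⁻ a, E a ∂μ : ℝ≥0∞) ≤ ((∫⁻ a, (f a).toENNReal ∂μ : ℝ≥0∞) : EReal)
        + (ENNReal.ofReal (-c) : ℝ≥0∞) := by exact_mod_cast hint
  rw [← hc, EReal.coe_ennreal_ofReal (x := -c)] at hint'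
  refine (EReal.addLECancellable_coe (max (-c) 0)) (le_trans (le_of_eq ?_) (hint'.trans
    (le_of_eq (add_comm _ _))))
  abel

end Expect

/-! ### From one observation to `n` -/

section Induction

variable {Z : Type*} [MeasurableSpace Z]

lemma lintegral_pi_fin_succ (P : Measure Z) [SigmaFinite P] {n : ℕ} {f : (Fin (n + 1) → Z) → ℝ≥0∞}
    (hf : Measurable f) :
    ∫⁻ z, f z ∂Measure.pi (fun _ => P)
      = ∫⁻ a, ∫⁻ z, f ((0 : Fin (n + 1)).insertNth a z) ∂Measure.pi (fun _ : Fin n => P) ∂P := by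
  have h := (measurePreserving_piFinSuccAbove (fun _ : Fin (n + 1) => P) 0).symm
  rw [← h.lintegral_comp hf, lintegral_prod]
  · rfl
  · exact (hf.comp (MeasurableEquiv.measurable _)).aemeasurable

/-- A lower bound for the errors of a pair of functions `u + v ≥ κ` under two distributions extends
from one to `n` observations. -/
lemma mul_le_lintegral_pi_add (P Q : Measure Z) [IsProbabilityMeasure P] [IsProbabilityMeasure Q]
    {κ : ℝ≥0∞} {G : ℕ → ℝ → ℝ → ℝ} (hG : ∀ s t, 0 ≤ s → 0 ≤ t → G 0 s t ≤ min s t)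
    (hstep : ∀ (n : ℕ) (U V : Z → ℝ≥0∞), Measurable U → Measurable V →
      (∀ z s t, 0 ≤ s → 0 ≤ t → κ * ENNReal.ofReal (G n s t)
        ≤ ENNReal.ofReal s * U z + ENNReal.ofReal t * V z) →
      ∀ s t, 0 ≤ s → 0 ≤ t → κ * ENNReal.ofReal (G (n + 1) s t)
        ≤ ENNReal.ofReal s * ∫⁻ z, U z ∂P + ENNReal.ofReal t * ∫⁻ z, V z ∂Q)
    (n : ℕ) {u v : (Fin n → Z) → ℝ≥0∞} (hu : Measurable u) (hv : Measurable v)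
    (huv : ∀ z, κ ≤ u z + v z) {s t : ℝ} (hs : 0 ≤ s) (ht : 0 ≤ t) :
    κ * ENNReal.ofReal (G n s t) ≤ ENNReal.ofReal s * ∫⁻ z, u z ∂Measure.pi (fun _ => P)
      + ENNReal.ofReal t * ∫⁻ z, v z ∂Measure.pi (fun _ => Q) := by
  -- The weights stay free because the first observation changes them.
  induction n generalizing s t with
  | zero =>
    rw [Measure.pi_of_empty, Measure.pi_of_empty, lintegral_dirac' _ hu, lintegral_dirac' _ hv]
    set a : Fin 0 → Z := isEmptyElim
    have h1 : ENNReal.ofReal (G 0 s t) ≤ ENNReal.ofReal s :=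
      ENNReal.ofReal_le_ofReal ((hG s t hs ht).trans (min_le_left _ _))
    have h2 : ENNReal.ofReal (G 0 s t) ≤ ENNReal.ofReal t :=
      ENNReal.ofReal_le_ofReal ((hG s t hs ht).trans (min_le_right _ _))
    calc κ * ENNReal.ofReal (G 0 s t)
        ≤ (u a + v a) * ENNReal.ofReal (G 0 s t) := by gcongr; exact huv _
      _ = ENNReal.ofReal (G 0 s t) * u a + ENNReal.ofReal (G 0 s t) * v a := by ring
      _ ≤ _ := by gcongr
  | succ n ih =>
    rw [lintegral_pi_fin_succ P hu, lintegral_pi_fin_succ Q hv]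
    have hcons : Measurable fun p : Z × (Fin n → Z) =>
        ((0 : Fin (n + 1)).insertNth p.1 p.2 : Fin (n + 1) → Z) :=
      (MeasurableEquiv.piFinSuccAbove (fun _ : Fin (n + 1) => Z) 0).symm.measurable
    -- `U` and `V` are the errors given the first observation, integrated over the `n` others.
    refine hstep n _ _ (hu.comp hcons).lintegral_prod_right' (hv.comp hcons).lintegral_prod_right'
      (fun z s t hs ht => ih (hu.comp (hcons.comp measurable_prodMk_left))
        (hv.comp (hcons.comp measurable_prodMk_left)) (fun _ => huv _) hs ht) s t hs ht

end Induction

/-! ### Conditional laws on the hypercube -/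

namespace Hypercube

variable {X Y : Type*} [MeasurableSpace X] [MeasurableSpace Y] {m : ℕ}

/-- The common first marginal of the distributions of the hypercube. -/
def marginal (H : Hypercube X Y m) : Measure X := (H.P (fun _ => true) : Measure (X × Y)).fst

instance (H : Hypercube X Y m) : IsProbabilityMeasure H.marginal := by
  unfold marginal; infer_instance

instance (H : Hypercube X Y m) (σ : Fin m → Bool) : IsMarkovKernel (H.cond σ) :=
  H.isMarkovKernel_cond σ

/-- The probability `p_b` of the output `h₁` on an edge of sign `b`. -/
def prob (H : Hypercube X Y m) (b : Bool) : ℝ := if b then H.pPlus else H.pMinus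

lemma prob_nonneg (H : Hypercube X Y m) (b : Bool) : 0 ≤ H.prob b := by
  have := H.pMinus_nonneg
  have := H.pMinus_lt_pPlus
  cases b <;> simp [prob] <;> linarith

lemma prob_le_one (H : Hypercube X Y m) (b : Bool) : H.prob b ≤ 1 := by
  have := H.pPlus_le_one
  have := H.pMinus_lt_pPlus
  cases b <;> simp [prob] <;> linarith

lemma P_eq (H : Hypercube X Y m) (σ : Fin m → Bool) :
    (H.P σ : Measure (X × Y)) = H.marginal ⊗ₘ H.cond σ := by
  rw [marginal, ← H.fst_eq σ]
  exact H.disintegration σ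

lemma marginal_part (H : Hypercube X Y m) (j : Fin m) :
    H.marginal (H.part j.succ) = ENNReal.ofReal H.w := by
  rw [← H.mass_part j, ofReal_measureReal]
  rfl

lemma w_nonneg (H : Hypercube X Y m) : 0 ≤ H.w := by
  rw [← H.mass_part ⟨0, H.dim_pos⟩]
  exact measureReal_nonneg

lemma w_le_one (H : Hypercube X Y m) : H.w ≤ 1 := by
  rw [← H.mass_part ⟨0, H.dim_pos⟩]
  exact measureReal_le_one

lemma exists_mem_part (H : Hypercube X Y m) (x : X) : ∃ j, x ∈ H.part j := by
  have : x ∈ ⋃ j, H.part j := H.iUnion_part ▸ Set.mem_univ x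
  exact Set.mem_iUnion.1 this

section Cond

variable [MeasurableSingletonClass Y]

/-- The two atoms already have total mass one, so nothing is left elsewhere. -/
lemma cond_eq (H : Hypercube X Y m) (σ : Fin m → Bool) (j : Fin m) {x : X}
    (hx : x ∈ H.part j.succ) :
    H.cond σ x = ENNReal.ofReal (H.prob (σ j)) • Measure.dirac H.h₁
      + ENNReal.ofReal (1 - H.prob (σ j)) • Measure.dirac H.h₂ := by
  have h1 : H.cond σ x {H.h₁} = ENNReal.ofReal (H.prob (σ j)) := by
    rw [prob, ← H.cond_h₁ σ j x hx, ofReal_measureReal]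
  have h2 : H.cond σ x {H.h₂} = ENNReal.ofReal (1 - H.prob (σ j)) := by
    rw [prob, ← H.cond_h₂ σ j x hx, ofReal_measureReal]
  have hd : Disjoint ({H.h₁} : Set Y) {H.h₂} := by simpa using H.h_ne
  have hu : H.cond σ x ({H.h₁} ∪ {H.h₂}) = 1 := by
    rw [measure_union hd (measurableSet_singleton _), h1, h2,
      ← ENNReal.ofReal_add (H.prob_nonneg _) (sub_nonneg.2 (H.prob_le_one _))]
    simp
  have hae : ∀ᵐ y ∂H.cond σ x, y ∈ ({H.h₁} ∪ {H.h₂} : Set Y) := by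
    rw [← mem_ae_iff_prob_eq_one ((measurableSet_singleton _).union (measurableSet_singleton _))]
      at hu
    exact hu
  rw [← h1, ← h2, ← Measure.restrict_singleton, ← Measure.restrict_singleton,
    ← Measure.restrict_union hd (measurableSet_singleton _), Measure.restrict_eq_self_of_ae_mem hae]

lemma lintegral_cond (H : Hypercube X Y m) (σ : Fin m → Bool) (j : Fin m) {x : X}
    (hx : x ∈ H.part j.succ) (f : Y → ℝ≥0∞) :
    ∫⁻ y, f y ∂H.cond σ x = ENNReal.ofReal (H.prob (σ j)) * f H.h₁
      + ENNReal.ofReal (1 - H.prob (σ j)) * f H.h₂ := by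
  rw [H.cond_eq σ j hx]
  simp

lemma integral_cond (H : Hypercube X Y m) (σ : Fin m → Bool) (j : Fin m) {x : X}
    (hx : x ∈ H.part j.succ) (f : Y → ℝ) :
    ∫ y, f y ∂H.cond σ x = H.prob (σ j) * f H.h₁ + (1 - H.prob (σ j)) * f H.h₂ := by
  have hi : ∀ (c : ℝ) (a : Y), Integrable f (ENNReal.ofReal c • Measure.dirac a) := fun c a =>
    (integrable_dirac (by simp)).smul_measure ENNReal.ofReal_ne_top
  rw [H.cond_eq σ j hx, integral_add_measure (hi _ _) (hi _ _), integral_smul_measure,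
    integral_smul_measure, integral_dirac, integral_dirac,
    ENNReal.toReal_ofReal (H.prob_nonneg _),
    ENNReal.toReal_ofReal (sub_nonneg.2 (H.prob_le_one _))]
  rfl

lemma ae_mem (H : Hypercube X Y m) (σ : Fin m → Bool) :
    ∀ᵐ z ∂(H.P σ : Measure (X × Y)), z.1 ∈ H.part 0 ∨ z.2 = H.h₁ ∨ z.2 = H.h₂ := by
  rw [H.P_eq σ]
  refine Measure.ae_compProd_of_ae_ae ?_ (Filter.Eventually.of_forall fun x => ?_)
  · exact (measurable_fst (H.measurableSet_part 0)).union
      ((measurable_snd (measurableSet_singleton H.h₁)).union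
        (measurable_snd (measurableSet_singleton H.h₂)))
  · obtain ⟨i, hi⟩ := H.exists_mem_part x
    induction i using Fin.cases with
    | zero => exact Filter.Eventually.of_forall fun _ => Or.inl hi
    | succ j =>
      rw [ae_iff, H.cond_eq σ j hi]
      simp

end Cond

/-- Off `X_j`, changing the sign `σ_j` does not change the distribution of the output. -/
lemma cond_congr [MeasurableSingletonClass Y] (H : Hypercube X Y m) {σ τ : Fin m → Bool}
    {j : Fin m} (h : ∀ i, i ≠ j → σ i = τ i) {x : X} (hx : x ∉ H.part j.succ) :
    H.cond σ x = H.cond τ x := by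
  obtain ⟨i, hi⟩ := H.exists_mem_part x
  induction i using Fin.cases with
  | zero => exact H.cond_zero σ τ x hi
  | succ i =>
    have hij : i ≠ j := fun h => hx (h ▸ hi)
    rw [H.cond_eq σ i hi, H.cond_eq τ i hi, h i hij]

/-! ### Replacing predictions on the cells -/

section Modification

variable {ℓ : Y → Y → ℝ}

/-- Making a prediction function constant on `X_1, …, X_m` changes its risk by a difference of
two-point risks. -/
lemma exists_modification [MeasurableSingletonClass Y] (H : Hypercube X Y m)
    (hℓ : Measurable (Function.uncurry ℓ))
    (σ : Fin m → Bool) {g : X → Y} (hg : Measurable g)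
    (hi : Integrable (fun z : X × Y => ℓ z.2 (g z.1)) (H.P σ)) (y : Fin m → Y) :
    ∃ g' : X → Y, Measurable g' ∧ (∀ j, ∀ x ∈ H.part j.succ, g' x = y j) ∧
      Integrable (fun z : X × Y => ℓ z.2 (g' z.1)) (H.P σ) ∧
      ∃ D : X → ℝ, Integrable D H.marginal ∧ (∀ x ∈ H.part 0, D x = 0) ∧
        (∀ j, ∀ x ∈ H.part j.succ, D x = twoPointRisk ℓ H.h₁ H.h₂ (H.prob (σ j)) (g x)
          - twoPointRisk ℓ H.h₁ H.h₂ (H.prob (σ j)) (y j)) ∧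
        ∫ z, ℓ z.2 (g z.1) ∂(H.P σ : Measure (X × Y))
          - ∫ z, ℓ z.2 (g' z.1) ∂(H.P σ : Measure (X × Y)) = ∫ x, D x ∂H.marginal := by
  obtain ⟨g', hg', hEq⟩ := exists_measurable_piecewise H.part H.measurableSet_part
    (Fin.cons g fun j _ => y j) (fun i => by
      induction i using Fin.cases with
      | zero => exact hg
      | succ j => exact measurable_const)
    (fun i k hik x hx => absurd hx.2 (Set.disjoint_left.1 (H.disjoint_part i k hik) hx.1))
  have h0 : ∀ x ∈ H.part 0, g' x = g x := fun x hx => hEq 0 hx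
  have h1 : ∀ j, ∀ x ∈ H.part j.succ, g' x = y j := fun j x hx => hEq j.succ hx
  have hmeas : ∀ {f : X → Y}, Measurable f → Measurable fun z : X × Y => ℓ z.2 (f z.1) :=
    fun hf => hℓ.comp (measurable_snd.prodMk (hf.comp measurable_fst))
  have hi' : Integrable (fun z : X × Y => ℓ z.2 (g' z.1)) (H.P σ) := by
    -- Almost surely, off `X_0` the new loss takes only the finitely many values `ℓ h₁ (y j)` and `ℓ
    -- h₂ (y j)`, and on `X_0` it is the old loss.
    refine (hi.norm.add (integrable_const (∑ j, (|ℓ H.h₁ (y j)| + |ℓ H.h₂ (y j)|)))).mono'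
      (hmeas hg').aestronglyMeasurable ?_
    filter_upwards [H.ae_mem σ] with z hz
    have hsum : ∀ j, |ℓ H.h₁ (y j)| + |ℓ H.h₂ (y j)|
        ≤ ∑ j, (|ℓ H.h₁ (y j)| + |ℓ H.h₂ (y j)|) := fun j =>
      Finset.single_le_sum (f := fun j => |ℓ H.h₁ (y j)| + |ℓ H.h₂ (y j)|)
        (fun _ _ => by positivity) (Finset.mem_univ j)
    have hnn : 0 ≤ ∑ j, (|ℓ H.h₁ (y j)| + |ℓ H.h₂ (y j)|) :=
      Finset.sum_nonneg fun _ _ => by positivity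
    simp only [Pi.add_apply, Real.norm_eq_abs]
    have ha := abs_nonneg (ℓ z.2 (g z.1))
    obtain ⟨i, hzi⟩ := H.exists_mem_part z.1
    induction i using Fin.cases with
    | zero => rw [h0 _ hzi]; linarith
    | succ j =>
      rw [h1 j _ hzi]
      have := hsum j
      have := abs_nonneg (ℓ H.h₁ (y j))
      have := abs_nonneg (ℓ H.h₂ (y j))
      rcases hz with hz | hz | hz
      · exact absurd hzi (Set.disjoint_left.1 (H.disjoint_part 0 j.succ (Fin.succ_ne_zero j).symm) hz)
      · rw [hz] at ha ⊢; linarith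
      · rw [hz] at ha ⊢; linarith
  have hsub := hi.sub hi'
  rw [H.P_eq σ] at hsub
  refine ⟨g', hg', h1, hi', fun x => ∫ b, (ℓ b (g x) - ℓ b (g' x)) ∂H.cond σ x,
    Integrable.integral_compProd (a := ()) hsub, fun x hx => by simp [h0 x hx], fun j x hx => ?_, ?_⟩
  · dsimp only
    rw [H.integral_cond σ j hx, h1 j x hx, twoPointRisk, twoPointRisk]
    ring
  · rw [← integral_sub hi hi', H.P_eq σ]
    exact Measure.integral_compProd hsub

lemma risk_eq_integral {P : ProbabilityMeasure (X × Y)} {g : X → Y}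
    (hi : Integrable (fun z : X × Y => ℓ z.2 (g z.1)) P) :
    risk ℓ P g = ((∫ z, ℓ z.2 (g z.1) ∂(P : Measure (X × Y)) : ℝ) : EReal) :=
  expect_coe_of_integrable hi

lemma integrable_of_risk_ne_top (hℓ : Measurable (Function.uncurry ℓ))
    {P : ProbabilityMeasure (X × Y)} (hP : optimalRisk ℓ P ≠ ⊥) {g : X → Y} (hg : Measurable g)
    (hr : risk ℓ P g ≠ ⊤) : Integrable (fun z : X × Y => ℓ z.2 (g z.1)) P := by
  refine integrable_of_expect_coe (hℓ.comp (measurable_snd.prodMk (hg.comp measurable_fst))) ?_ hr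
  exact ne_bot_of_le_ne_bot hP (iInf₂_le g hg)

/-- If the optimal risks are finite and the edges have positive mass, then the two-point risks are
bounded below. -/
lemma bddBelow_twoPointRisk [MeasurableSingletonClass Y] (H : Hypercube X Y m)
    (hℓ : Measurable (Function.uncurry ℓ))
    (hopt : ∀ σ, optimalRisk ℓ (H.P σ) ≠ ⊥ ∧ optimalRisk ℓ (H.P σ) ≠ ⊤) (hw : 0 < H.w) (b : Bool) :
    BddBelow (Set.range (twoPointRisk ℓ H.h₁ H.h₂ (H.prob b))) := by
  obtain ⟨hbot, htop⟩ := hopt fun _ => b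
  set P := H.P fun _ => b
  obtain ⟨g, hg, hgt⟩ : ∃ g, Measurable g ∧ risk ℓ P g ≠ ⊤ := by
    by_contra! h
    exact htop (by simp only [optimalRisk, iInf_eq_top]; exact h)
  have hi := integrable_of_risk_ne_top hℓ hbot hg hgt
  -- The reference `g₁` predicts `h₁` on all cells. Passing from it to the constant `y` there lowers
  -- the risk by `c` times the difference of the two-point risks, and the risk cannot drop below
  -- `r`; this gives the bound used below.
  obtain ⟨g₁, hg₁, hg₁y, hi₁, -⟩ := H.exists_modification hℓ _ hg hi fun _ => H.h₁
  set c : ℝ := H.marginal.real (H.part 0)ᶜ with hc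
  have hcpos : 0 < c := by
    refine hw.trans_le ?_
    rw [← H.mass_part ⟨0, H.dim_pos⟩]
    exact measureReal_mono (Set.disjoint_right.1 (H.disjoint_part 0 _ (Fin.succ_ne_zero _).symm))
  lift optimalRisk ℓ P to ℝ using ⟨htop, hbot⟩ with r hr
  refine ⟨twoPointRisk ℓ H.h₁ H.h₂ (H.prob b) H.h₁
    - (∫ z, ℓ z.2 (g₁ z.1) ∂(P : Measure (X × Y)) - r) / c, ?_⟩
  rintro _ ⟨y, rfl⟩
  obtain ⟨g₂, hg₂, -, hi₂, D, -, hD0, hD1, hD⟩ := H.exists_modification hℓ _ hg₁ hi₁ fun _ => y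
  have hDeq : D = (H.part 0)ᶜ.indicator fun _ => twoPointRisk ℓ H.h₁ H.h₂ (H.prob b) H.h₁
      - twoPointRisk ℓ H.h₁ H.h₂ (H.prob b) y := by
    ext x
    by_cases hx : x ∈ H.part 0
    · rw [hD0 x hx, Set.indicator_of_notMem (by simpa using hx)]
    · rw [Set.indicator_of_mem (by simpa using hx)]
      obtain ⟨i, hxi⟩ := H.exists_mem_part x
      induction i using Fin.cases with
      | zero => exact absurd hxi hx
      | succ j => rw [hD1 j x hxi, hg₁y j x hxi]
  have hint : ∫ x, D x ∂H.marginal = c * (twoPointRisk ℓ H.h₁ H.h₂ (H.prob b) H.h₁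
      - twoPointRisk ℓ H.h₁ H.h₂ (H.prob b) y) := by
    rw [hDeq, integral_indicator_const _ (H.measurableSet_part 0).compl, smul_eq_mul]
  have hr₂ : r ≤ ∫ z, ℓ z.2 (g₂ z.1) ∂(P : Measure (X × Y)) := by
    rw [← EReal.coe_le_coe_iff, hr, ← risk_eq_integral hi₂]
    exact iInf₂_le g₂ hg₂
  rw [hint] at hD
  rw [sub_le_comm, le_div_iff₀ hcpos]
  linarith

end Modification

/-! ### Excess risk carried by the cells -/

section Excess

variable {ℓ : Y → Y → ℝ}

/-- The excess two-point risk of the output `y` on an edge of sign `b`. -/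
def edgeExcess (H : Hypercube X Y m) (ℓ : Y → Y → ℝ) (b : Bool) (y : Y) : ℝ≥0∞ :=
  ENNReal.ofReal (twoPointRisk ℓ H.h₁ H.h₂ (H.prob b) y
    - bestTwoPointRisk ℓ H.h₁ H.h₂ (H.prob b))

lemma measurable_edgeExcess (H : Hypercube X Y m) (hℓ : Measurable (Function.uncurry ℓ))
    (b : Bool) : Measurable (H.edgeExcess ℓ b) := by
  have h : ∀ a, Measurable (ℓ a) := fun a => hℓ.of_uncurry_left
  exact ((((h _).const_mul _).add ((h _).const_mul _)).sub_const _).ennreal_ofReal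

/-- The part of the excess risk under `P_σ` that comes from `X_1, …, X_m` is a lower bound for the
excess risk. -/
lemma optimalRisk_add_le_risk [MeasurableSingletonClass Y] (H : Hypercube X Y m)
    (hℓ : Measurable (Function.uncurry ℓ))
    {σ : Fin m → Bool} (hbot : optimalRisk ℓ (H.P σ) ≠ ⊥)
    (hbdd : ∀ b, BddBelow (Set.range (twoPointRisk ℓ H.h₁ H.h₂ (H.prob b))))
    {g : X → Y} (hg : Measurable g) :
    optimalRisk ℓ (H.P σ)
      + (∑ j, ∫⁻ x in H.part j.succ, H.edgeExcess ℓ (σ j) (g x) ∂H.marginal : ℝ≥0∞)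
        ≤ risk ℓ (H.P σ) g := by
  by_cases hr : risk ℓ (H.P σ) g = ⊤
  · rw [hr]; exact le_top
  have hi := integrable_of_risk_ne_top hℓ hbot hg hr
  have htop : optimalRisk ℓ (H.P σ) ≠ ⊤ := ne_top_of_le_ne_top hr (iInf₂_le g hg)
  rw [risk_eq_integral hi]
  set R : ℝ := ∫ z, ℓ z.2 (g z.1) ∂(H.P σ : Measure (X × Y))
  lift optimalRisk ℓ (H.P σ) to ℝ using ⟨htop, hbot⟩ with r hropt
  have hrR : r ≤ R := by
    rw [← EReal.coe_le_coe_iff, hropt, ← risk_eq_integral hi]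
    exact iInf₂_le g hg
  suffices h : ∑ j, ∫⁻ x in H.part j.succ, H.edgeExcess ℓ (σ j) (g x) ∂H.marginal
      ≤ ENNReal.ofReal (R - r) by
    calc (r : EReal) + (∑ j, ∫⁻ x in H.part j.succ, H.edgeExcess ℓ (σ j) (g x) ∂H.marginal : ℝ≥0∞)
        ≤ r + (ENNReal.ofReal (R - r) : ℝ≥0∞) := by
          gcongr
          exact EReal.coe_ennreal_le_coe_ennreal_iff.2 h
      _ = R := by
          rw [EReal.coe_ennreal_ofReal, max_eq_left (sub_nonneg.2 hrR)]
          norm_cast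
          ring
  -- The two-point infimum need not be attained, so the comparison uses `ε`-minimisers `y j`.
  refine ENNReal.le_of_forall_pos_le_add fun ε hε _ => ?_
  have hne : Nonempty Y := ⟨H.h₁⟩
  have hε' : (0 : ℝ) < ε := hε
  choose y hy using fun j => exists_lt_of_ciInf_lt
    (lt_add_of_pos_right (bestTwoPointRisk ℓ H.h₁ H.h₂ (H.prob (σ j))) hε')
  obtain ⟨g', hg', -, hi', D, hDi, hD0, hD1, hD⟩ := H.exists_modification hℓ σ hg hi y
  have hge : ∀ j, ∀ x ∈ H.part j.succ, twoPointRisk ℓ H.h₁ H.h₂ (H.prob (σ j)) (g x)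
      - bestTwoPointRisk ℓ H.h₁ H.h₂ (H.prob (σ j)) ≤ D x + ε := fun j x hx => by
    rw [hD1 j x hx]
    linarith [hy j]
  have hnn : ∀ x, 0 ≤ D x + ε := fun x => by
    obtain ⟨i, hxi⟩ := H.exists_mem_part x
    induction i using Fin.cases with
    | zero => rw [hD0 x hxi]; linarith
    | succ j => exact (sub_nonneg.2 (ciInf_le (hbdd _) (g x))).trans (hge j x hxi)
  have hr' : r ≤ ∫ z, ℓ z.2 (g' z.1) ∂(H.P σ : Measure (X × Y)) := by
    rw [← EReal.coe_le_coe_iff, hropt, ← risk_eq_integral hi']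
    exact iInf₂_le g' hg'
  calc ∑ j, ∫⁻ x in H.part j.succ, H.edgeExcess ℓ (σ j) (g x) ∂H.marginal
      ≤ ∑ j : Fin m, ∫⁻ x in H.part j.succ, ENNReal.ofReal (D x + ε) ∂H.marginal := by
        refine Finset.sum_le_sum fun j _ => ?_
        exact setLIntegral_mono' (H.measurableSet_part _) fun x hx =>
          ENNReal.ofReal_le_ofReal (hge j x hx)
    -- Adding the cell `X_0` completes the partition; there `D` vanishes and the integrand is `ε`.
    _ ≤ ∑ i, ∫⁻ x in H.part i, ENNReal.ofReal (D x + ε) ∂H.marginal := by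
        rw [Fin.sum_univ_succ]
        exact le_add_self
    _ = ∫⁻ x, ENNReal.ofReal (D x + ε) ∂H.marginal := by
        rw [← tsum_fintype (L := .unconditional _), ← lintegral_iUnion H.measurableSet_part
          (fun i k h => H.disjoint_part i k h), H.iUnion_part, Measure.restrict_univ]
    _ = ENNReal.ofReal (∫ x, D x ∂H.marginal + ε) := by
        have hadd : ∫ x, (D x + ε) ∂H.marginal = ∫ x, D x ∂H.marginal + ε := by
          rw [integral_add hDi (integrable_const _)]
          simp
        rw [← hadd]
        exact (ofReal_integral_eq_lintegral_ofReal (hDi.add (integrable_const _))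
          (Filter.Eventually.of_forall hnn)).symm
    _ ≤ ENNReal.ofReal (R - r) + ENNReal.ofReal ε := by
        refine le_trans (ENNReal.ofReal_le_ofReal ?_) ENNReal.ofReal_add_le
        linarith
    _ = ENNReal.ofReal (R - r) + ε := by rw [ENNReal.ofReal_coe_nnreal]

end Excess

/-! ### Testing recursions and edge discrepancies -/

/-- `G n s t` is a lower bound for `s α + t β`, where `α` and `β` are the errors of a test of a
positive against a negative edge which observes `n` pairs. -/
structure IsEdgeTestBound (H : Hypercube X Y m) (G : ℕ → ℝ → ℝ → ℝ) : Prop where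
  zero_le_min : ∀ s t, 0 ≤ s → 0 ≤ t → G 0 s t ≤ min s t
  succ_le : ∀ n s t, 0 ≤ s → 0 ≤ t → G (n + 1) s t ≤ (1 - H.w) * G n s t
    + H.w * (G n (s * H.pPlus) (t * H.pMinus) + G n (s * (1 - H.pPlus)) (t * (1 - H.pMinus)))

/-- The squared affinity inside the cell is `1 - dII`; averaging with the uninformative outside
gives `1 - w * dII` per observation. -/
lemma isEdgeTestBound_testBound (H : Hypercube X Y m) :
    H.IsEdgeTestBound fun n => testBound ((1 - H.w * H.dII) ^ n) := by
  have hp := H.prob_nonneg true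
  have hp1 := H.prob_le_one true
  have hq := H.prob_nonneg false
  have hq1 := H.prob_le_one false
  simp only [prob, if_true, Bool.false_eq_true, if_false] at hp hp1 hq hq1
  have haff := sqrt_mul_add_sqrt_mul_sq hp hp1 hq hq1
  have hγ : 1 - H.w * H.dII = 1 - H.w + H.w
      * (√(H.pPlus * H.pMinus) + √((1 - H.pPlus) * (1 - H.pMinus))) ^ 2 := by
    rw [haff, dII]; ring
  have hw := H.w_nonneg
  have hw1 := H.w_le_one
  have hγ0 : 0 ≤ 1 - H.w * H.dII := by
    rw [hγ]
    have := sub_nonneg.2 hw1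
    positivity
  have hγ1 : 1 - H.w * H.dII ≤ 1 := by
    have : 0 ≤ H.dII := sq_nonneg _
    have := mul_nonneg hw this
    linarith
  refine ⟨fun s t _ _ => ?_, fun n s t hs ht => ?_⟩
  · simp only [pow_zero, testBound_one, le_refl]
  · have h := testBound_mul_le (pow_nonneg hγ0 n) (pow_le_one₀ hγ0 hγ1) hs ht hw hw1 hp hp1 hq hq1
    rwa [← hγ, ← pow_succ] at h

/-- A single observation in the cell reveals the sign, since it sends one of the two weights to `0`.
Only samples that miss the cell contribute, and the recursion is an equality. -/
lemma isEdgeTestBound_min (H : Hypercube X Y m) (hp : H.pPlus = 1) (hq : H.pMinus = 0) :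
    H.IsEdgeTestBound fun n s t => min s t * (1 - H.w) ^ n := by
  refine ⟨fun s t _ _ => by simp, fun n s t hs ht => ?_⟩
  simp only [hp, hq, mul_one, mul_zero, sub_self, sub_zero, min_eq_right hs, min_eq_left ht]
  apply le_of_eq
  ring

lemma two_mul_dI (H : Hypercube X Y m) (ℓ : Y → Y → ℝ) :
    2 * H.dI ℓ = 2 * bestTwoPointRisk ℓ H.h₁ H.h₂ ((H.prob true + H.prob false) / 2)
      - bestTwoPointRisk ℓ H.h₁ H.h₂ (H.prob true)
      - bestTwoPointRisk ℓ H.h₁ H.h₂ (H.prob false) := by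
  have : (1 / 2 : ℝ) * H.pPlus + (1 - 1 / 2) * H.pMinus = (H.prob true + H.prob false) / 2 := by
    simp only [prob, if_true, Bool.false_eq_true, if_false]
    ring
  rw [dI, psi, this]
  simp only [prob, if_true, Bool.false_eq_true, if_false]
  ring

/-- An infimum of affine functions of `p` is concave, here at the midpoint. -/
lemma dI_nonneg (H : Hypercube X Y m) {ℓ : Y → Y → ℝ}
    (hbdd : ∀ b, BddBelow (Set.range (twoPointRisk ℓ H.h₁ H.h₂ (H.prob b)))) : 0 ≤ H.dI ℓ := by
  have hne : Nonempty Y := ⟨H.h₁⟩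
  have h : (bestTwoPointRisk ℓ H.h₁ H.h₂ (H.prob true)
      + bestTwoPointRisk ℓ H.h₁ H.h₂ (H.prob false)) / 2
        ≤ bestTwoPointRisk ℓ H.h₁ H.h₂ ((H.prob true + H.prob false) / 2) := by
    refine le_ciInf fun y => ?_
    have h1 : bestTwoPointRisk ℓ H.h₁ H.h₂ (H.prob true) ≤ _ := ciInf_le (hbdd true) y
    have h2 : bestTwoPointRisk ℓ H.h₁ H.h₂ (H.prob false) ≤ _ := ciInf_le (hbdd false) y
    simp only [twoPointRisk] at h1 h2 ⊢
    linarith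
  linarith [H.two_mul_dI ℓ]

/-- The two-point risk is affine in `p`, so the risks of `y` at the two signs add up to twice its
risk at the midpoint, which is at least twice the infimum there. -/
lemma ofReal_two_mul_dI_le (H : Hypercube X Y m) {ℓ : Y → Y → ℝ}
    (hbdd : ∀ b, BddBelow (Set.range (twoPointRisk ℓ H.h₁ H.h₂ (H.prob b)))) (y : Y) :
    ENNReal.ofReal (2 * H.dI ℓ) ≤ H.edgeExcess ℓ true y + H.edgeExcess ℓ false y := by
  -- A real infimum over a set unbounded below takes the default value `0`, so boundedness at the
  -- midpoint has to be established.
  have hmid : BddBelow (Set.range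
      (twoPointRisk ℓ H.h₁ H.h₂ ((H.prob true + H.prob false) / 2))) := by
    obtain ⟨a, ha⟩ := hbdd true
    obtain ⟨b, hb⟩ := hbdd false
    refine ⟨(a + b) / 2, ?_⟩
    rintro _ ⟨y, rfl⟩
    have h1 := ha ⟨y, rfl⟩
    have h2 := hb ⟨y, rfl⟩
    simp only [twoPointRisk] at h1 h2 ⊢
    linarith
  have h := ciInf_le hmid y
  refine le_trans (ENNReal.ofReal_le_ofReal ?_) ENNReal.ofReal_add_le
  rw [H.two_mul_dI ℓ]
  have hsum : 2 * twoPointRisk ℓ H.h₁ H.h₂ ((H.prob true + H.prob false) / 2) y =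
      twoPointRisk ℓ H.h₁ H.h₂ (H.prob true) y + twoPointRisk ℓ H.h₁ H.h₂ (H.prob false) y := by
    simp only [twoPointRisk]
    ring
  simp only [bestTwoPointRisk] at h ⊢
  linarith

lemma dII_nonneg (H : Hypercube X Y m) : 0 ≤ H.dII := sq_nonneg _

lemma dII_le_one (H : Hypercube X Y m) : H.dII ≤ 1 := by
  have hp := H.prob_nonneg true
  have hp1 := H.prob_le_one true
  have hq := H.prob_nonneg false
  have hq1 := H.prob_le_one false
  simp only [prob, if_true, Bool.false_eq_true, if_false] at hp hp1 hq hq1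
  have h := sqrt_mul_add_sqrt_mul_sq hp hp1 hq hq1
  have h0 := sq_nonneg (√(H.pPlus * H.pMinus) + √((1 - H.pPlus) * (1 - H.pMinus)))
  rw [dII]
  linarith

/-- The expected excess risk on `X_j` under `P_σ` of an estimator. -/
def expectedEdgeExcess (H : Hypercube X Y m) (ℓ : Y → Y → ℝ) {n : ℕ}
    (gHat : (Fin n → X × Y) → X → Y) (σ : Fin m → Bool) (j : Fin m) : ℝ≥0∞ :=
  ∫⁻ x in H.part j.succ, ∫⁻ z, H.edgeExcess ℓ (σ j) (gHat z x)
    ∂Measure.pi (fun _ => (H.P σ : Measure (X × Y))) ∂H.marginal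

lemma lintegral_sum_edgeExcess (H : Hypercube X Y m) {ℓ : Y → Y → ℝ} {n : ℕ}
    {gHat : (Fin n → X × Y) → X → Y} (hℓ : Measurable (Function.uncurry ℓ))
    (hg : Measurable (Function.uncurry gHat)) (σ : Fin m → Bool) :
    ∫⁻ z, ∑ j, ∫⁻ x in H.part j.succ, H.edgeExcess ℓ (σ j) (gHat z x) ∂H.marginal
        ∂Measure.pi (fun _ => (H.P σ : Measure (X × Y)))
      = ∑ j, H.expectedEdgeExcess ℓ gHat σ j := by
  have hm : ∀ b, Measurable fun p : (Fin n → X × Y) × X => H.edgeExcess ℓ b (gHat p.1 p.2) :=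
    fun b => (H.measurable_edgeExcess hℓ b).comp hg
  rw [lintegral_finsetSum _ fun j _ => (hm (σ j)).lintegral_prod_right']
  exact Finset.sum_congr rfl fun j _ => lintegral_lintegral_swap (hm (σ j)).aemeasurable

/-! ### Two-point bounds and averaging over the cube -/

variable [MeasurableSingletonClass Y]

/-- The pair is disintegrated over its input. In the cell, the hypothesis is applied at `h₁` and
`h₂` with weights multiplied by the likelihoods; off the cell the two conditional laws agree and the
weights are kept. -/
lemma edge_step_le (H : Hypercube X Y m) {σ τ : Fin m → Bool} {j : Fin m}
    (hne : ∀ i, i ≠ j → σ i = τ i) (hσ : σ j = true) (hτ : τ j = false) {κ : ℝ≥0∞}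
    {G : ℝ → ℝ → ℝ} {U V : X × Y → ℝ≥0∞} (hU : Measurable U) (hV : Measurable V)
    (h : ∀ z s t, 0 ≤ s → 0 ≤ t →
      κ * ENNReal.ofReal (G s t) ≤ ENNReal.ofReal s * U z + ENNReal.ofReal t * V z)
    {s t c : ℝ} (hs : 0 ≤ s) (ht : 0 ≤ t) (hc : c ≤ (1 - H.w) * G s t + H.w
      * (G (s * H.pPlus) (t * H.pMinus) + G (s * (1 - H.pPlus)) (t * (1 - H.pMinus)))) :
    κ * ENNReal.ofReal c ≤ ENNReal.ofReal s * ∫⁻ z, U z ∂(H.P σ : Measure (X × Y))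
      + ENNReal.ofReal t * ∫⁻ z, V z ∂(H.P τ : Measure (X × Y)) := by
  have hp := H.prob_nonneg true
  have hp1 := sub_nonneg.2 (H.prob_le_one true)
  have hq := H.prob_nonneg false
  have hq1 := sub_nonneg.2 (H.prob_le_one false)
  set A := H.part j.succ with hA
  have hAm : MeasurableSet A := H.measurableSet_part _
  have hμA : H.marginal A = ENNReal.ofReal H.w := H.marginal_part j
  have hμA' : H.marginal Aᶜ = ENNReal.ofReal (1 - H.w) := by
    rw [prob_compl_eq_one_sub hAm, hμA, ENNReal.ofReal_sub _ H.w_nonneg, ENNReal.ofReal_one]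
  have hUσ : Measurable fun x => ∫⁻ y, U (x, y) ∂H.cond σ x := hU.lintegral_kernel_prod_right'
  have hVτ : Measurable fun x => ∫⁻ y, V (x, y) ∂H.cond τ x := hV.lintegral_kernel_prod_right'
  rw [H.P_eq, H.P_eq, Measure.lintegral_compProd hU, Measure.lintegral_compProd hV,
    ← lintegral_const_mul _ hUσ, ← lintegral_const_mul _ hVτ,
    ← lintegral_add_left (hUσ.const_mul _), ← lintegral_add_compl _ hAm]
  set a := G (s * H.pPlus) (t * H.pMinus)
  set b := G (s * (1 - H.pPlus)) (t * (1 - H.pMinus))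
  have hin : ∀ x ∈ A, κ * ENNReal.ofReal a + κ * ENNReal.ofReal b
      ≤ ENNReal.ofReal s * ∫⁻ y, U (x, y) ∂H.cond σ x
        + ENNReal.ofReal t * ∫⁻ y, V (x, y) ∂H.cond τ x := fun x hx => by
    rw [H.lintegral_cond σ j hx, H.lintegral_cond τ j hx, hσ, hτ]
    have h1 := h (x, H.h₁) _ _ (mul_nonneg hs hp) (mul_nonneg ht hq)
    have h2 := h (x, H.h₂) _ _ (mul_nonneg hs hp1) (mul_nonneg ht hq1)
    rw [ENNReal.ofReal_mul hs, ENNReal.ofReal_mul ht] at h1 h2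
    refine (add_le_add h1 h2).trans (le_of_eq ?_)
    ring
  have hout : ∀ x ∈ Aᶜ, κ * ENNReal.ofReal (G s t)
      ≤ ENNReal.ofReal s * ∫⁻ y, U (x, y) ∂H.cond σ x
        + ENNReal.ofReal t * ∫⁻ y, V (x, y) ∂H.cond τ x := fun x hx => by
    have hUx : Measurable fun y => U (x, y) := hU.comp measurable_prodMk_left
    have hVx : Measurable fun y => V (x, y) := hV.comp measurable_prodMk_left
    rw [H.cond_congr hne hx, ← lintegral_const_mul _ hUx, ← lintegral_const_mul _ hVx,
      ← lintegral_add_left (hUx.const_mul _)]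
    calc κ * ENNReal.ofReal (G s t) = ∫⁻ _, κ * ENNReal.ofReal (G s t) ∂H.cond τ x := by simp
      _ ≤ _ := lintegral_mono fun y => h (x, y) s t hs ht
  calc κ * ENNReal.ofReal c
      ≤ κ * (ENNReal.ofReal ((1 - H.w) * G s t) + ENNReal.ofReal (H.w * (a + b))) := by
        gcongr
        exact (ENNReal.ofReal_le_ofReal hc).trans ENNReal.ofReal_add_le
    _ ≤ κ * (ENNReal.ofReal (1 - H.w) * ENNReal.ofReal (G s t)
          + ENNReal.ofReal H.w * (ENNReal.ofReal a + ENNReal.ofReal b)) := by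
        rw [ENNReal.ofReal_mul (sub_nonneg.2 H.w_le_one), ENNReal.ofReal_mul H.w_nonneg]
        gcongr
        exact ENNReal.ofReal_add_le
    _ = ∫⁻ _ in A, (κ * ENNReal.ofReal a + κ * ENNReal.ofReal b) ∂H.marginal
          + ∫⁻ _ in Aᶜ, κ * ENNReal.ofReal (G s t) ∂H.marginal := by
        rw [setLIntegral_const, setLIntegral_const, hμA, hμA']
        ring
    _ ≤ _ := add_le_add (setLIntegral_mono' hAm hin) (setLIntegral_mono' hAm.compl hout)

lemma mul_le_lintegral_pi_edge (H : Hypercube X Y m) {G : ℕ → ℝ → ℝ → ℝ} (hG : H.IsEdgeTestBound G)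
    {σ τ : Fin m → Bool} {j : Fin m} (hne : ∀ i, i ≠ j → σ i = τ i) (hσ : σ j = true)
    (hτ : τ j = false) {κ : ℝ≥0∞} {n : ℕ} {u v : (Fin n → X × Y) → ℝ≥0∞} (hu : Measurable u)
    (hv : Measurable v) (huv : ∀ z, κ ≤ u z + v z) :
    κ * ENNReal.ofReal (G n 1 1) ≤ ∫⁻ z, u z ∂Measure.pi (fun _ => (H.P σ : Measure (X × Y)))
      + ∫⁻ z, v z ∂Measure.pi (fun _ => (H.P τ : Measure (X × Y))) := by
  have h := mul_le_lintegral_pi_add (H.P σ : Measure (X × Y)) (H.P τ : Measure (X × Y))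
    hG.zero_le_min (fun n U V hU hV h s t hs ht => H.edge_step_le hne hσ hτ hU hV h hs ht
      (hG.succ_le n s t hs ht)) n hu hv huv zero_le_one zero_le_one
  simpa using h

variable {ℓ : Y → Y → ℝ} {n : ℕ} {gHat : (Fin n → X × Y) → X → Y} {G : ℕ → ℝ → ℝ → ℝ}

/-- At each fixed `x` of the cell, the two excesses of the prediction act as the errors of a test
with total at least `2 * dI`; integrating over the cell brings in its mass `w`. -/
lemma le_expectedEdgeExcess_add (H : Hypercube X Y m) (hℓ : Measurable (Function.uncurry ℓ))
    (hbdd : ∀ b, BddBelow (Set.range (twoPointRisk ℓ H.h₁ H.h₂ (H.prob b))))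
    (hg : Measurable (Function.uncurry gHat)) (hG : H.IsEdgeTestBound G)
    {σ τ : Fin m → Bool} {j : Fin m} (hne : ∀ i, i ≠ j → σ i = τ i) (hσ : σ j = true)
    (hτ : τ j = false) :
    ENNReal.ofReal H.w * (ENNReal.ofReal (2 * H.dI ℓ) * ENNReal.ofReal (G n 1 1))
      ≤ H.expectedEdgeExcess ℓ gHat σ j + H.expectedEdgeExcess ℓ gHat τ j := by
  have hm : ∀ b, Measurable fun p : X × (Fin n → X × Y) => H.edgeExcess ℓ b (gHat p.2 p.1) :=
    fun b => (H.measurable_edgeExcess hℓ b).comp (hg.comp measurable_swap)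
  rw [expectedEdgeExcess, expectedEdgeExcess, hσ, hτ,
    ← lintegral_add_left (hm true).lintegral_prod_right', ← H.marginal_part j, mul_comm,
    ← setLIntegral_const]
  refine lintegral_mono fun x => ?_
  exact H.mul_le_lintegral_pi_edge hG hne hσ hτ ((hm true).comp measurable_prodMk_left)
    ((hm false).comp measurable_prodMk_left) fun z => H.ofReal_two_mul_dI_le hbdd _

/-- Averaging over the hypercube. -/
lemma exists_le_sum_expectedEdgeExcess (H : Hypercube X Y m)
    (hℓ : Measurable (Function.uncurry ℓ))
    (hbdd : ∀ b, BddBelow (Set.range (twoPointRisk ℓ H.h₁ H.h₂ (H.prob b))))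
    (hg : Measurable (Function.uncurry gHat)) (hG : H.IsEdgeTestBound G) :
    ∃ σ, ENNReal.ofReal (m * H.w * H.dI ℓ * G n 1 1)
      ≤ ∑ j, H.expectedEdgeExcess ℓ gHat σ j := by
  by_contra! hlt
  set L := H.expectedEdgeExcess ℓ gHat
  set r := m * H.w * H.dI ℓ * G n 1 1
  set c := ENNReal.ofReal H.w * (ENNReal.ofReal (2 * H.dI ℓ) * ENNReal.ofReal (G n 1 1)) with hc
  have hr : 2 * ENNReal.ofReal r = m * c := by
    have h1 : 2 * r = m * (H.w * (2 * H.dI ℓ * G n 1 1)) := by simp only [r]; ring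
    have h2 : (2 : ℝ≥0∞) = ENNReal.ofReal 2 := by simp
    rw [h2, ← ENNReal.ofReal_mul zero_le_two, h1, ENNReal.ofReal_mul (Nat.cast_nonneg _),
      ENNReal.ofReal_mul H.w_nonneg,
      ENNReal.ofReal_mul (mul_nonneg zero_le_two (H.dI_nonneg hbdd)), ENNReal.ofReal_natCast]
  -- Flipping one sign permutes the cube, so summing the pair bound over all `σ` counts each vertex
  -- twice; this absorbs the `2` of `2 * dI`.
  have hflip : ∀ j, Function.Involutive fun σ : Fin m → Bool => Function.update σ j (!σ j) :=
    fun j σ => by simp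
  have hpair : ∀ j σ, c ≤ L σ j + L (Function.update σ j (!σ j)) j := fun j σ => by
    have hne : ∀ i, i ≠ j → σ i = Function.update σ j (!σ j) i := fun i hi => by simp [hi]
    cases hσ : σ j with
    | true =>
      rw [hσ] at hne
      exact H.le_expectedEdgeExcess_add hℓ hbdd hg hG hne hσ (by simp)
    | false =>
      rw [hσ] at hne
      rw [add_comm]
      exact H.le_expectedEdgeExcess_add hℓ hbdd hg hG (fun i hi => (hne i hi).symm) (by simp) hσ
  have hlow : ∀ j, ∑ _σ : Fin m → Bool, c ≤ 2 * ∑ σ, L σ j := fun j => by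
    have hsum : ∑ σ : Fin m → Bool, L (Function.update σ j (!σ j)) j = ∑ σ, L σ j :=
      Equiv.sum_comp (hflip j).toPerm fun σ => L σ j
    rw [two_mul]
    nth_rewrite 2 [← hsum]
    rw [← Finset.sum_add_distrib]
    exact Finset.sum_le_sum fun σ _ => hpair j σ
  have hlt' : ∑ σ, ∑ j, L σ j < ∑ _σ : Fin m → Bool, ENNReal.ofReal r :=
    ENNReal.sum_lt_sum_of_nonempty Finset.univ_nonempty fun σ _ => hlt σ
  have hlt2 : 2 * ∑ σ, ∑ j, L σ j < 2 * ∑ _σ : Fin m → Bool, ENNReal.ofReal r :=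
    (ENNReal.mul_lt_mul_iff_right two_ne_zero ENNReal.ofNat_ne_top).2 hlt'
  refine hlt2.not_ge ?_
  rw [Finset.mul_sum, Finset.sum_comm, Finset.mul_sum]
  simp only [hr]
  calc ∑ _σ : Fin m → Bool, m * c = ∑ _j : Fin m, ∑ _σ : Fin m → Bool, c := by
        rw [Finset.sum_comm]
        simp
    _ ≤ _ := Finset.sum_le_sum fun j _ => hlow j

/-- Every lower bound for the tests of an edge gives a lower bound for the largest expected excess
risk. -/
lemma le_maxExcessRisk (H : Hypercube X Y m) (hℓ : Measurable (Function.uncurry ℓ))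
    {𝓟 : Set (ProbabilityMeasure (X × Y))} (hH : ∀ σ, H.P σ ∈ 𝓟)
    (hopt : ∀ σ, optimalRisk ℓ (H.P σ) ≠ ⊥ ∧ optimalRisk ℓ (H.P σ) ≠ ⊤)
    (hg : Measurable (Function.uncurry gHat)) (hG : H.IsEdgeTestBound G) :
    ((m * H.w * H.dI ℓ * G n 1 1 : ℝ) : EReal) ≤ maxExcessRisk ℓ 𝓟 gHat := by
  have hgz : ∀ z, Measurable (gHat z) := fun z => hg.of_uncurry_left
  have main : ∀ σ (E : (Fin n → X × Y) → ℝ≥0∞), Measurable E →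
      (∀ z, optimalRisk ℓ (H.P σ) + E z ≤ risk ℓ (H.P σ) (gHat z)) →
      ((∫⁻ z, E z ∂Measure.pi (fun _ => (H.P σ : Measure (X × Y))) : ℝ≥0∞) : EReal)
        ≤ maxExcessRisk ℓ 𝓟 gHat := fun σ E hE h => by
    refine le_trans ?_ (le_iSup₂ (f := fun P _ => expectedRisk ℓ P gHat - optimalRisk ℓ P)
      (H.P σ) (hH σ))
    obtain ⟨hbot, htop⟩ := hopt σ
    lift optimalRisk ℓ (H.P σ) to ℝ using ⟨htop, hbot⟩ with r
    rw [EReal.le_sub_iff_add_le (Or.inl (EReal.coe_ne_bot r)) (Or.inl (EReal.coe_ne_top r)),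
      add_comm]
    exact le_expect_of_forall_add_le hE h
  -- If `w = 0` the two-point infima may be default values, but the bound is `0` and excess risks
  -- are nonnegative.
  rcases H.w_nonneg.eq_or_lt with hw | hw
  · have h := main (fun _ => true) (fun _ => 0) measurable_const fun z => by
      rw [EReal.coe_ennreal_zero, add_zero]
      exact iInf₂_le (gHat z) (hgz z)
    simpa [← hw] using h
  · have hbdd := H.bddBelow_twoPointRisk hℓ hopt hw
    obtain ⟨σ, hσ⟩ := H.exists_le_sum_expectedEdgeExcess hℓ hbdd hg hG
    have hm : Measurable fun z => ∑ j, ∫⁻ x in H.part j.succ,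
        H.edgeExcess ℓ (σ j) (gHat z x) ∂H.marginal :=
      Finset.measurable_fun_sum _ fun j _ =>
        ((H.measurable_edgeExcess hℓ (σ j)).comp hg).lintegral_prod_right'
    have h := main σ _ hm fun z => H.optimalRisk_add_le_risk hℓ (hopt σ).1 hbdd (hgz z)
    rw [H.lintegral_sum_edgeExcess hℓ hg] at h
    refine le_trans ?_ ((EReal.coe_ennreal_le_coe_ennreal_iff.2 hσ).trans h)
    rw [EReal.coe_ennreal_ofReal]
    exact EReal.coe_le_coe_iff.2 (le_max_left _ _)

end Hypercube

end Learning

end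

/-! ### The minimax lower bounds -/

theorem theorem8p2 {X Y : Type*} [MeasurableSpace X] [MeasurableSpace Y]
    [MeasurableSingletonClass Y]
    (ℓ : Y → Y → ℝ) (hℓ : Measurable (Function.uncurry ℓ))
    (𝓟 : Set (ProbabilityMeasure (X × Y)))
    (h𝓟 : ∀ P ∈ 𝓟, Learning.optimalRisk ℓ P ≠ ⊥ ∧ Learning.optimalRisk ℓ P ≠ ⊤)
    {m : ℕ} (H : Learning.Hypercube X Y m) (hH : ∀ σ, H.P σ ∈ 𝓟)
    (n : ℕ) (hn : 1 ≤ n)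
    (gHat : (Fin n → X × Y) → X → Y) (hg : Measurable (Function.uncurry gHat)) :
    (((m * H.w * H.dI ℓ * (1 - √(1 - (1 - H.dII) ^ ((n : ℝ) * H.w))) : ℝ) : EReal)
        ≤ Learning.maxExcessRisk ℓ 𝓟 gHat) ∧
    (((m * H.w * H.dI ℓ * (1 - √(n * H.w * H.dII)) : ℝ) : EReal)
        ≤ Learning.maxExcessRisk ℓ 𝓟 gHat) ∧
    (1 ≤ (n : ℝ) * H.w →
      m * H.w * H.dI ℓ * (1 - √(n * H.w * H.dII))
        ≤ m * H.w * H.dI ℓ * (1 - √(1 - (1 - H.dII) ^ ((n : ℝ) * H.w)))) ∧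
    (H.pPlus = 1 → 1 - H.pMinus = 1 →
      ((m * H.w * H.dI ℓ * (1 - H.w) ^ n : ℝ) : EReal)
        ≤ Learning.maxExcessRisk ℓ 𝓟 gHat) := by
  have hopt := fun σ => h𝓟 _ (hH σ)
  have hw := H.w_nonneg
  have hw1 := H.w_le_one
  have hd := H.dII_nonneg
  have hd1 := H.dII_le_one
  -- This bound, stronger than both of the first item, is `testBound u 1 1 = 1 - √(1 - u)` at `u =
  -- (1 - w * dII) ^ n`.
  have hlow : ((m * H.w * H.dI ℓ * (1 - √(1 - (1 - H.w * H.dII) ^ n)) : ℝ) : EReal)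
      ≤ Learning.maxExcessRisk ℓ 𝓟 gHat := by
    have h := H.le_maxExcessRisk (n := n) hℓ hH hopt hg H.isEdgeTestBound_testBound
    norm_num [Learning.testBound] at h
    exact_mod_cast h
  have hdI : 0 ≤ m * H.w * H.dI ℓ := by
    rcases hw.eq_or_lt with h | h
    · simp [← h]
    · have := H.dI_nonneg (H.bddBelow_twoPointRisk hℓ hopt h)
      positivity
  refine ⟨le_trans (EReal.coe_le_coe_iff.2 ?_) hlow, le_trans (EReal.coe_le_coe_iff.2 ?_) hlow,
    fun hnw => ?_, fun hp hq => ?_⟩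
  · gcongr
    exact Learning.rpow_mul_le_one_sub_mul_pow hd1 hw hw1 n
  · gcongr
    -- Bernoulli's inequality with natural exponent holds for increments down to `-2`.
    have h2 : -2 ≤ -(H.w * H.dII) := by
      linarith [mul_le_one₀ hw1 hd hd1]
    have := one_add_mul_le_pow h2 n
    rw [← sub_eq_add_neg] at this
    linarith
  · gcongr
    -- For real exponents, Bernoulli's inequality has this direction only from exponent `1` on,
    -- hence the condition on `n * w`.
    have := one_add_mul_self_le_rpow_one_add (s := -H.dII) (by linarith) hnw
    rw [← sub_eq_add_neg] at this
    linarith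
  · have h := H.le_maxExcessRisk (n := n) hℓ hH hopt hg
      (H.isEdgeTestBound_min hp (by linarith))
    simpa using h
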